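/- Let $\mathcal K$ be a set of measurable cardinals (a measurable cardinal is an uncountable cardinal $\kappa$ carrying a $\kappa$-complete nonprincipal ultrafilter), let $\lambda=\sup\mathcal K$, and let $\theta$ be a regular cardinal with $\mathcal P(\mathcal P(\lambda))\in H_\theta$. Then for every countable elementary submodel $M\prec H_\theta$, player PII has a winning strategy in the game $\mathcal G_1(M,\mathcal K)$. Here, for a set $N$ and $x\in\bigcup N$, $\mathrm{Hull}(N,x)=\{f(x): f\in N \text{ a function},\ x\in\mathrm{dom}(f)\}$, and the game $\mathcal G_1(M,\mathcal K)$ of length $\omega$ is played as follows. Put $M_0=M$. In round $n<\omega$: 1. PI plays a regular cardinal $\lambda_n\in M_n$ with $\omega_1<\lambda_n<\lambda$ and $\lambda_n\notin\mathcal K$. 2. PII plays a pair $(\lambda_n,\beta_n)$ with $\beta_n\in\lambda_n$. 3. PI plays a pair $(\kappa_n,\nu_n)$ with $\kappa_n\in\mathcal K\cap M_n$ and $\nu_n\in\kappa_n$. 4. PII plays an ordinal $\xi_n\in\kappa_n\setminus\nu_n$ such that, with $M_{n+1}=\mathrm{Hull}(M_n,\xi_n)$, one has $M_{n+1}\cap\omega_1=M_n\cap\omega_1$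 and $\sup(M_{n+1}\cap\lambda_i)\le\beta_i$ for every $i\le n$. PII loses if in some round PII fails to make a move obeying these rules, and wins otherwise (in particular PII does not lose if PI has no legal move). -/

import Mathlib

universe u

namespace NambaGame

/-! ### Set-theoretic background

The universe of sets is `ZFSet.{u}`; ordinals, and cardinals regarded as sets, are von Neumann
ordinals. -/

/-- A cardinal regarded as a set: the von Neumann ordinal of its initial ordinal. -/
noncomputable def cardSet (c : Cardinal.{u}) : ZFSet.{u} := c.ord.toZFSet

/-- `ω₁` as a set. -/
noncomputable def omegaOne : ZFSet.{u} := cardSet (Cardinal.aleph 1)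

/-- The set `x` is a regular (infinite) cardinal. -/
def IsRegularCardinal (x : ZFSet.{u}) : Prop :=
  ∃ c : Cardinal.{u}, c.IsRegular ∧ x = cardSet c

/-- The cardinal `c` is measurable: it is uncountable and there is a `c`-complete nonprincipal
ultrafilter on it. -/
def MeasurableCardinal (c : Cardinal.{u}) : Prop :=
  Cardinal.aleph0 < c ∧
    ∃ U : Ultrafilter c.ord.ToType,
      (∀ α : c.ord.ToType, ({α} : Set c.ord.ToType) ∉ U) ∧
        CardinalInterFilter (U : Filter c.ord.ToType) c

/-- The set `x` is a measurable cardinal. -/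
def IsMeasurableCardinal (x : ZFSet.{u}) : Prop :=
  ∃ c : Cardinal.{u}, MeasurableCardinal c ∧ x = cardSet c

/-- `H_θ`, the collection of all sets whose transitive closure has cardinality less than `θ`,
that is, which are included in a transitive set of cardinality less than `θ`. -/
def H (θ : Cardinal.{u}) : Set ZFSet.{u} :=
  {x | ∃ t : ZFSet.{u}, t.IsTransitive ∧ x ⊆ t ∧ t.card < θ}

/-- `x ≪ θ`: the double power set of `x` belongs to `H_θ`. -/
def MuchLess (x : ZFSet.{u}) (θ : Cardinal.{u}) : Prop :=
  x.powerset.powerset ∈ H θ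

/-- The only symbol of the language of set theory: a binary relation symbol. -/
inductive MemRel : ℕ → Type
  | mem : MemRel 2

/-- The first-order language of set theory. -/
def setLanguage : FirstOrder.Language := ⟨fun _ => Empty, MemRel⟩

/-- `(H_θ, ∈)` as a first-order structure. -/
instance structureH (θ : Cardinal.{u}) : setLanguage.Structure (H θ) where
  funMap := fun f => nomatch f
  RelMap := fun r => match r with
    | MemRel.mem => fun xs => (xs 0 : ZFSet.{u}) ∈ (xs 1 : ZFSet.{u})

/-- The elements of an elementary submodel `M ≺ H_θ`. -/
def elements {θ : Cardinal.{u}} (M : setLanguage.ElementarySubstructure (H θ)) :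
    Set ZFSet.{u} :=
  {x | ∃ y : H θ, y ∈ M ∧ (y : ZFSet.{u}) = x}

/-- The set `f` is a function: a single-valued set of ordered pairs. -/
def IsFunction (f : ZFSet.{u}) : Prop :=
  (∀ z ∈ f, ∃ a b, z = ZFSet.pair a b) ∧
    ∀ a b c, ZFSet.pair a b ∈ f → ZFSet.pair a c ∈ f → b = c

/-- `Hull(M, x) = {f(x) : f ∈ M, x ∈ dom(f)}`, where `f` ranges over functions. -/
def Hull (M : Set ZFSet.{u}) (x : ZFSet.{u}) : Set ZFSet.{u} :=
  {y | ∃ f ∈ M, IsFunction f ∧ ZFSet.pair x y ∈ f}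

/-! ### The game -/

/-- The moves of one round: PI plays `lam`, PII answers with the pair `(lam, beta)`, PI plays the
pair `(kappa, nu)`, PII answers with `xi`. -/
structure Round : Type (u + 1) where
  lam : ZFSet.{u}
  beta : ZFSet.{u}
  kappa : ZFSet.{u}
  nu : ZFSet.{u}
  xi : ZFSet.{u}

/-- The model `M_n` reached after the `n` rounds listed in `r` (the most recent round is the head
of the list): `M_0 = M` and `M_{n+1} = Hull(M_n, ξ_n)`. -/
def model (M : Set ZFSet.{u}) : List Round.{u} → Set ZFSet.{u}
  | [] => M
  | a :: r => Hull (model M r) a.xi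

/-- The set `Promise_n` after the rounds listed in `r`. -/
def promise (r : List Round.{u}) : Set (ZFSet.{u} × ZFSet.{u}) :=
  {p | ∃ a ∈ r, p = (a.lam, a.beta)}

/-- Rules for the first move `lam` of PI in the round after `r`; here `λ = sup K` is the union
of `K`. -/
def LegalLam (M : Set ZFSet.{u}) (K : ZFSet.{u}) (r : List Round.{u}) (lam : ZFSet.{u}) : Prop :=
  lam ∈ model M r ∧ IsRegularCardinal lam ∧ omegaOne ∈ lam ∧ lam ∈ K.sUnion ∧ lam ∉ K

/-- Rules for the second move `(kappa, nu)` of PI in the round after `r`. -/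
def LegalKappa (M : Set ZFSet.{u}) (K : ZFSet.{u}) (r : List Round.{u})
    (kappa nu : ZFSet.{u}) : Prop :=
  kappa ∈ K ∧ kappa ∈ model M r ∧ nu ∈ kappa

/-- Rules for the second move of PII, the ordinal `a.xi`, in the round `a` after `r`: `ξ_n`
belongs to `κ_n \ ν_n`, the new model has the same countable ordinals as the old one, and
`sup (M_{n+1} ∩ κ) ≤ β` for all promises `(κ, β)` made so far, those of this round included. -/
def LegalXi (M : Set ZFSet.{u}) (r : List Round.{u}) (a : Round.{u}) : Prop :=
  a.xi ∈ a.kappa ∧ a.xi ∉ a.nu ∧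
    model M (a :: r) ∩ (omegaOne.{u} : Set ZFSet.{u}) =
      model M r ∩ (omegaOne.{u} : Set ZFSet.{u}) ∧
    ∀ p ∈ promise (a :: r), ∀ α ∈ model M (a :: r), α ∈ p.1 → α ⊆ p.2

/-- A strategy for PII: it tells PII, from the rounds completed so far and the moves already made
in the current round, how to choose `beta` and how to choose `xi`. -/
structure Strategy : Type (u + 1) where
  beta : (r : List Round.{u}) → (lam : ZFSet.{u}) → ZFSet.{u}
  xi : (r : List Round.{u}) → (lam beta kappa nu : ZFSet.{u}) → ZFSet.{u}

/-- The round after `r` in which PI plays `lam` and `(kappa, nu)` and PII follows `S`. -/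
def Strategy.round (S : Strategy.{u}) (r : List Round.{u}) (lam kappa nu : ZFSet.{u}) :
    Round.{u} where
  lam := lam
  beta := S.beta r lam
  kappa := kappa
  nu := nu
  xi := S.xi r lam (S.beta r lam) kappa nu

/-- The finite runs, consisting of completed rounds, in which PI obeys the rules, PII follows `S`,
and PII has not lost. -/
inductive Strategy.Run (M : Set ZFSet.{u}) (K : ZFSet.{u}) (S : Strategy.{u}) :
    List Round.{u} → Prop
  | nil : Strategy.Run M K S []
  | cons {r : List Round.{u}} {lam kappa nu : ZFSet.{u}} :
      Strategy.Run M K S r → LegalLam M K r lam → S.beta r lam ∈ lam →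
      LegalKappa M K r kappa nu → LegalXi M r (S.round r lam kappa nu) →
      Strategy.Run M K S (S.round r lam kappa nu :: r)

/-- The strategy `S` is winning for PII: if PII follows `S`, then PII never loses, that is, in
each round that is reached PII's answers obey the rules, whatever PI legally plays. -/
def Strategy.IsWinning (M : Set ZFSet.{u}) (K : ZFSet.{u}) (S : Strategy.{u}) : Prop :=
  ∀ r, S.Run M K r → ∀ lam, LegalLam M K r lam →
    S.beta r lam ∈ lam ∧
      ∀ kappa nu, LegalKappa M K r kappa nu → LegalXi M r (S.round r lam kappa nu)

/-- PII has a winning strategy in the game `G₁(M, K)`. -/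
def PIIHasWinningStrategy (M : Set ZFSet.{u}) (K : ZFSet.{u}) : Prop :=
  ∃ S : Strategy.{u}, S.IsWinning M K

end NambaGame

namespace NambaGame

open FirstOrder FirstOrder.Language Cardinal

/-! ### Closure properties of `H_θ` -/

section HTheta

variable {θ : Cardinal.{u}} {x y : ZFSet.{u}}

/-! PII keeps every M_n countable and elementary, and answers λ_n with a bound of M_n ∩ λ_n, which
exists because λ_n is regular and uncountable. When PI plays κ, elementarity puts a κ-complete
measure U on κ into M_n. For f ∈ M_n and γ < κ, f is constant on a set in U or avoids γ on one; the
constant is definable from f and U, so it can be found in M_n (`Elem.exists_homogeneous`). For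
countably many γ, completeness gives one ξ ≥ ν in all these sets, and then Hull(M_n, ξ) has no new
elements below any of these γ (`Elem.exists_hull_inter_subset`).

With γ = ω₁ and γ = λ_i < κ this settles ω₁ and the promises below κ. Promises at κ do not occur, as
λ_i ∉ K. If λ_i > κ, the values below λ_i of a function in M_n on κ are bounded by regularity, with
a bound in M_n, so the supremum does not grow (`Elem.hull_bounded`). Hulls are again elementary
(`Elem.hull`), so the play continues. -/

theorem H_mem_trans (hx : x ∈ H θ) (hy : y ∈ x) : y ∈ H θ := by
  obtain ⟨t, ht, hxt, hc⟩ := hx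
  exact ⟨t, ht, ht.subset_of_mem (hxt hy), hc⟩

theorem H_subset (hx : x ∈ H θ) (hy : y ⊆ x) : y ∈ H θ := by
  obtain ⟨t, ht, hxt, hc⟩ := hx
  exact ⟨t, ht, fun _ h => hxt (hy h), hc⟩

theorem card_lt_of_mem_H (hx : x ∈ H θ) : x.card < θ := by
  obtain ⟨t, -, hxt, hc⟩ := hx
  exact (ZFSet.card_mono hxt).trans_lt hc

/-- Regularity of θ keeps the union of fewer than θ transitive sets, each smaller than θ, smaller
than θ. -/
theorem mem_H_of_forall_mem (hθ : θ.IsRegular) (hx : ∀ y ∈ x, y ∈ H θ) (hc : x.card < θ) :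
    x ∈ H θ := by
  choose! t ht hyt htc using hx
  let f : Shrink.{u} x → ZFSet.{u} := fun i => t ((equivShrink x).symm i)
  have hf : ∀ i, ((equivShrink x).symm i : ZFSet) ∈ x := fun i => ((equivShrink x).symm i).2
  have hmem : ∀ y ∈ x, ∃ i, f i = t y := fun y hy =>
    ⟨equivShrink x ⟨y, hy⟩, by simp [f]⟩
  refine ⟨x ∪ ZFSet.iUnion f, ?_, fun y hy => ZFSet.mem_union.2 (Or.inl hy), ?_⟩
  · intro y hy z hz
    refine ZFSet.mem_union.2 (Or.inr (ZFSet.mem_iUnion.2 ?_))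
    rcases ZFSet.mem_union.1 hy with hy | hy
    · obtain ⟨i, hi⟩ := hmem y hy
      exact ⟨i, by change z ∈ f i; rw [hi]; exact hyt y hy hz⟩
    · obtain ⟨i, hi⟩ := ZFSet.mem_iUnion.1 hy
      exact ⟨i, (ht _ (hf i)).subset_of_mem hi hz⟩
  · refine ZFSet.card_union_le.trans_lt (add_lt_of_lt hθ.aleph0_le hc ?_)
    have h := ZFSet.lift_card_iUnion_le_sum_card (f := f)
    rw [lift_id] at h
    refine h.trans_lt (sum_lt_of_isRegular hθ hc fun i => htc _ (hf i))

theorem empty_mem_H (hθ : θ.IsRegular) : (∅ : ZFSet.{u}) ∈ H θ :=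
  mem_H_of_forall_mem hθ (by simp) (by simpa using hθ.pos)

theorem pairSet_mem_H (hθ : θ.IsRegular) (hx : x ∈ H θ) (hy : y ∈ H θ) :
    ({x, y} : ZFSet.{u}) ∈ H θ := by
  refine mem_H_of_forall_mem hθ (by simp [hx, hy]) ?_
  refine lt_of_le_of_lt ?_ ((natCast_lt_aleph0 (n := 2)).trans_le hθ.aleph0_le)
  refine ZFSet.card_insert_le.trans ?_
  rw [ZFSet.card_singleton]
  norm_num

theorem singleton_mem_H (hθ : θ.IsRegular) (hx : x ∈ H θ) : ({x} : ZFSet.{u}) ∈ H θ := by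
  simpa using pairSet_mem_H hθ hx hx

theorem pair_mem_H (hθ : θ.IsRegular) (hx : x ∈ H θ) (hy : y ∈ H θ) : ZFSet.pair x y ∈ H θ :=
  pairSet_mem_H hθ (singleton_mem_H hθ hx) (pairSet_mem_H hθ hx hy)

theorem of_pair_mem_H {z : ZFSet.{u}} (hz : z ∈ H θ) (h : z = ZFSet.pair x y) :
    x ∈ H θ ∧ y ∈ H θ := by
  have : ({x, y} : ZFSet) ∈ H θ := H_mem_trans hz (by simp [h, ZFSet.pair])
  exact ⟨H_mem_trans this (by simp), H_mem_trans this (by simp)⟩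

theorem H_ext {a b : H θ} :
    a = b ↔ ∀ u : H θ, (u : ZFSet) ∈ (a : ZFSet) ↔ (u : ZFSet) ∈ (b : ZFSet) := by
  refine ⟨fun h _ => h ▸ Iff.rfl, fun h => Subtype.ext (ZFSet.ext fun z => ?_)⟩
  exact ⟨fun hz => (h ⟨z, H_mem_trans a.2 hz⟩).1 hz, fun hz => (h ⟨z, H_mem_trans b.2 hz⟩).2 hz⟩

/-- Functions chosen outside H_θ thereby become elements of it, so that elementarity can reflect
their existence. -/
theorem exists_graph_mem_H (hθ : θ.IsRegular) (hx : x ∈ H θ) (F : ZFSet.{u} → ZFSet.{u})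
    (hF : ∀ z ∈ x, F z ∈ H θ) :
    ∃ g ∈ H θ, IsFunction g ∧ ∀ z y, ZFSet.pair z y ∈ g ↔ z ∈ x ∧ y = F z := by
  let G : Shrink.{u} x → ZFSet.{u} := fun i =>
    ZFSet.pair ((equivShrink x).symm i) (F ((equivShrink x).symm i))
  have hG : ∀ w, w ∈ ZFSet.range G ↔ ∃ z ∈ x, w = ZFSet.pair z (F z) := by
    intro w
    rw [ZFSet.mem_range]
    constructor
    · rintro ⟨i, rfl⟩
      exact ⟨_, ((equivShrink x).symm i).2, rfl⟩
    · rintro ⟨z, hz, rfl⟩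
      exact ⟨equivShrink x ⟨z, hz⟩, by simp [G]⟩
  have hp : ∀ z y, ZFSet.pair z y ∈ ZFSet.range G ↔ z ∈ x ∧ y = F z := by
    intro z y
    rw [hG]
    constructor
    · rintro ⟨z', hz', h⟩
      obtain ⟨rfl, rfl⟩ := ZFSet.pair_inj.1 h
      exact ⟨hz', rfl⟩
    · rintro ⟨hz, rfl⟩
      exact ⟨z, hz, rfl⟩
  refine ⟨ZFSet.range G, mem_H_of_forall_mem hθ ?_ ?_, ⟨?_, ?_⟩, hp⟩
  · intro w hw
    obtain ⟨z, hz, rfl⟩ := (hG w).1 hw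
    exact pair_mem_H hθ (H_mem_trans hx hz) (hF z hz)
  · have h := ZFSet.lift_card_range_le (f := G)
    rw [lift_id, lift_id] at h
    exact h.trans_lt (card_lt_of_mem_H hx)
  · intro w hw
    obtain ⟨z, -, rfl⟩ := (hG w).1 hw
    exact ⟨_, _, rfl⟩
  · intro a b c hb hc
    rw [((hp _ _).1 hb).2, ((hp _ _).1 hc).2]

end HTheta

/-! ### Definable predicates on `H_θ` -/

/-- The predicate `T` on assignments of elements of `H_θ` to the variables in `α` is first-order
definable without parameters. -/
def Def {θ : Cardinal.{u}} {α : Type} (T : (α → H θ) → Prop) : Prop :=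
  ∃ φ : setLanguage.Formula α, ∀ v, φ.Realize v ↔ T v

/-- The membership symbol of the language of set theory. -/
def memSymbol : setLanguage.Relations 2 := MemRel.mem

namespace Def

variable {θ : Cardinal.{u}} {α β : Type} {S T : (α → H θ) → Prop}

theorem of_iff (hS : Def S) (h : ∀ v, S v ↔ T v) : Def T :=
  hS.imp fun _ hφ v => (hφ v).trans (h v)

theorem mem (i j : α) : Def fun v : α → H θ => (v i : ZFSet) ∈ (v j : ZFSet) :=
  ⟨Relations.formula₂ memSymbol (Term.var i) (Term.var j), fun _ => Formula.realize_rel₂⟩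

theorem eq (i j : α) : Def fun v : α → H θ => v i = v j :=
  ⟨Term.equal (Term.var i) (Term.var j), fun v => by simp⟩

theorem not (hT : Def T) : Def fun v => ¬ T v := by
  obtain ⟨φ, hφ⟩ := hT
  exact ⟨φ.not, fun v => by simp [hφ]⟩

theorem and (hS : Def S) (hT : Def T) : Def fun v => S v ∧ T v := by
  obtain ⟨φ, hφ⟩ := hS
  obtain ⟨ψ, hψ⟩ := hT
  exact ⟨φ ⊓ ψ, fun v => by simp [hφ, hψ]⟩

theorem or (hS : Def S) (hT : Def T) : Def fun v => S v ∨ T v := by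
  obtain ⟨φ, hφ⟩ := hS
  obtain ⟨ψ, hψ⟩ := hT
  exact ⟨φ ⊔ ψ, fun v => by simp [hφ, hψ]⟩

theorem imp (hS : Def S) (hT : Def T) : Def fun v => S v → T v := by
  obtain ⟨φ, hφ⟩ := hS
  obtain ⟨ψ, hψ⟩ := hT
  exact ⟨φ.imp ψ, fun v => by simp [hφ, hψ]⟩

theorem iff (hS : Def S) (hT : Def T) : Def fun v => (S v ↔ T v) := by
  obtain ⟨φ, hφ⟩ := hS
  obtain ⟨ψ, hψ⟩ := hT
  exact ⟨φ.iff ψ, fun v => by simp [hφ, hψ]⟩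

theorem relabel (hT : Def T) (σ : α → β) : Def fun v : β → H θ => T fun i => v (σ i) := by
  obtain ⟨φ, hφ⟩ := hT
  exact ⟨Formula.relabel σ φ, fun v => by rw [Formula.realize_relabel, hφ]; rfl⟩

theorem forall_finite [Finite β] {T : β → (α → H θ) → Prop} (hT : ∀ i, Def (T i)) :
    Def fun v => ∀ i, T i v := by
  choose φ hφ using hT
  exact ⟨Formula.iInf φ, fun v => by simp [hφ]⟩

/-- Needed in `Elem.hull`, which quantifies over a whole tuple of parameters at once. -/
theorem alls [Finite β] {T : (α → H θ) → (β → H θ) → Prop}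
    (hT : Def fun v : α ⊕ β → H θ => T (fun i => v (Sum.inl i)) fun j => v (Sum.inr j)) :
    Def fun v => ∀ w, T v w := by
  obtain ⟨φ, hφ⟩ := hT
  exact ⟨φ.iAlls β, fun v => by simp [Formula.realize_iAlls, hφ]⟩

theorem all {T : (α → H θ) → H θ → Prop}
    (hT : Def fun v : Option α → H θ => T (fun i => v (some i)) (v none)) :
    Def fun v => ∀ x, T v x := by
  have h := alls (β := Unit) (T := fun v w => T v (w ()))
    (hT.relabel fun o => o.elim (Sum.inr ()) Sum.inl)
  exact h.of_iff fun v => ⟨fun h x => h fun _ => x, fun h w => h _⟩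

theorem ex {T : (α → H θ) → H θ → Prop}
    (hT : Def fun v : Option α → H θ => T (fun i => v (some i)) (v none)) :
    Def fun v => ∃ x, T v x := by
  have h := (all (T := fun v x => ¬ T v x) hT.not).not
  simpa using h

/-- Absoluteness: H_θ is transitive and closed under pairing, so quantifiers over H_θ suffice. The
same applies to the next three predicates. -/
theorem pairSet (hθ : θ.IsRegular) (i j k : α) :
    Def fun v : α → H θ => (v i : ZFSet) = {(v j : ZFSet), (v k : ZFSet)} := by
  have h : Def fun v : α → H θ => ∀ u : H θ, (u : ZFSet) ∈ (v i : ZFSet) ↔ u = v j ∨ u = v k :=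
    all (iff (mem _ _) (or (eq _ _) (eq _ _)))
  refine h.of_iff fun v => ?_
  have := H_ext (a := v i) (b := ⟨_, pairSet_mem_H hθ (v j).2 (v k).2⟩)
  rw [Subtype.ext_iff] at this
  rw [this]
  simp [Subtype.ext_iff]

theorem pair (hθ : θ.IsRegular) (i j k : α) :
    Def fun v : α → H θ => (v i : ZFSet) = ZFSet.pair (v j) (v k) := by
  have h : Def fun v : α → H θ => ∀ u : H θ, (u : ZFSet) ∈ (v i : ZFSet) ↔
      (u : ZFSet) = {(v j : ZFSet), (v j : ZFSet)} ∨ (u : ZFSet) = {(v j : ZFSet), (v k : ZFSet)} :=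
    all (iff (mem _ _) (or (pairSet hθ _ _ _) (pairSet hθ _ _ _)))
  refine h.of_iff fun v => ?_
  have := H_ext (a := v i) (b := ⟨_, pair_mem_H hθ (v j).2 (v k).2⟩)
  rw [Subtype.ext_iff] at this
  rw [this]
  simp [ZFSet.pair]

theorem pairMem (hθ : θ.IsRegular) (i j k : α) :
    Def fun v : α → H θ => ZFSet.pair (v i) (v j) ∈ (v k : ZFSet) := by
  have h : Def fun v : α → H θ => ∃ z : H θ, (z : ZFSet) ∈ (v k : ZFSet) ∧
      (z : ZFSet) = ZFSet.pair (v i) (v j) := ex (and (mem _ _) (pair hθ _ _ _))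
  refine h.of_iff fun v => ⟨?_, fun h => ⟨⟨_, H_mem_trans (v k).2 h⟩, h, rfl⟩⟩
  rintro ⟨z, hz, h⟩
  exact h ▸ hz

theorem isFunction (hθ : θ.IsRegular) (i : α) : Def fun v : α → H θ => IsFunction (v i) := by
  have h : Def fun v : α → H θ =>
      (∀ z : H θ, (z : ZFSet) ∈ (v i : ZFSet) → ∃ a b : H θ, (z : ZFSet) = ZFSet.pair a b) ∧
      ∀ a b c : H θ, ZFSet.pair a b ∈ (v i : ZFSet) → ZFSet.pair a c ∈ (v i : ZFSet) → b = c :=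
    and (all (imp (mem _ _) (ex (ex (pair hθ _ _ _)))))
      (all (all (all (imp (pairMem hθ _ _ _) (imp (pairMem hθ _ _ _) (eq _ _))))))
  refine h.of_iff fun v => and_congr ⟨fun h z hz => ?_, fun h z hz => ?_⟩
    ⟨fun h a b c hb hc => ?_, fun h a b c hb hc => Subtype.ext (h _ _ _ hb hc)⟩
  · obtain ⟨a, b, e⟩ := h ⟨z, H_mem_trans (v i).2 hz⟩ hz
    exact ⟨a, b, e⟩
  · obtain ⟨a, b, e⟩ := h z hz
    obtain ⟨ha, hb⟩ := of_pair_mem_H z.2 e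
    exact ⟨⟨a, ha⟩, ⟨b, hb⟩, e⟩
  · obtain ⟨ha, hb'⟩ := of_pair_mem_H (H_mem_trans (v i).2 hb) rfl
    obtain ⟨-, hc'⟩ := of_pair_mem_H (H_mem_trans (v i).2 hc) rfl
    exact congrArg Subtype.val (h ⟨a, ha⟩ ⟨b, hb'⟩ ⟨c, hc'⟩ hb hc)

end Def

/-! ### Elementary sets and their hulls -/

/-- The set `N` of elements of `H_θ` meets every nonempty set that is definable over `H_θ` with
parameters in `N`. -/
structure Elem (θ : Cardinal.{u}) (N : Set ZFSet.{u}) : Prop where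
  subset_H : ∀ x ∈ N, x ∈ H θ
  exists_mem : ∀ {α : Type} [Finite α] (T : (α → H θ) → H θ → Prop),
    (Def fun v : Option α → H θ => T (fun i => v (some i)) (v none)) →
    ∀ p : α → H θ, (∀ i, (p i : ZFSet) ∈ N) → (∃ g, T p g) → ∃ g : H θ, (g : ZFSet) ∈ N ∧ T p g

theorem elem_elements {θ : Cardinal.{u}} (M : setLanguage.ElementarySubstructure (H θ)) :
    Elem θ (elements M) where
  subset_H := by
    rintro _ ⟨y, -, rfl⟩
    exact y.2
  exists_mem := by
    intro α _ T hT p hp hg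
    obtain ⟨φ, hφ⟩ := hT
    have hp' : ∀ i, p i ∈ M := fun i => by
      obtain ⟨y, hy, h⟩ := hp i
      rwa [← Subtype.ext h]
    let q : α → M := fun i => ⟨p i, hp' i⟩
    let σ : Option α → α ⊕ Unit := fun o => o.elim (Sum.inr ()) Sum.inl
    let ψ : setLanguage.Formula α := (Formula.relabel σ φ).iExs Unit
    have h1 : ψ.Realize (M.subtype ∘ q) := by
      obtain ⟨g, hg⟩ := hg
      rw [Formula.realize_iExs]
      refine ⟨fun _ => g, ?_⟩
      rw [Formula.realize_relabel, hφ]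
      exact hg
    -- Elementarity is used twice: downwards for the existential formula, then upwards for its
    -- witness.
    rw [M.subtype.map_formula, Formula.realize_iExs] at h1
    obtain ⟨w, hw⟩ := h1
    rw [Formula.realize_relabel, ← M.subtype.map_formula, hφ] at hw
    exact ⟨w (), ⟨w (), (w ()).2, rfl⟩, hw⟩

namespace Elem

variable {θ : Cardinal.{u}} {N : Set ZFSet.{u}} {κ ξ : ZFSet.{u}}

/-- Skolem functions: if the parameters are f_i(ξ), some g ∈ N sends each z ∈ κ to a witness for the
parameters f_i(z) whenever there is one, and g(ξ) is the witness required. -/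
theorem hull (hθ : θ.IsRegular) (hN : Elem θ N) (hκ : κ ∈ N) (hξ : ξ ∈ κ) :
    Elem θ (Hull N ξ) where
  subset_H := by
    rintro y ⟨f, hf, -, hy⟩
    exact (of_pair_mem_H (H_mem_trans (hN.subset_H f hf) hy) rfl).2
  exists_mem := by
    intro α _ T hT p hp ⟨y₀, hy₀⟩
    choose f hf hfun hfp using hp
    have hκH := hN.subset_H κ hκ
    -- The variable `none` stands for κ and `some i` for f_i.
    let R : (Option α → H θ) → H θ → Prop := fun v g => IsFunction g ∧
      ∀ z : H θ, (z : ZFSet) ∈ (v none : ZFSet) → ∀ w : α → H θ,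
        (∀ i, ZFSet.pair z (w i) ∈ (v (some i) : ZFSet)) → ∀ y, T w y →
          ∃ y' : H θ, ZFSet.pair z y' ∈ (g : ZFSet) ∧ T w y'
    have hR : Def fun v : Option (Option α) → H θ => R (fun i => v (some i)) (v none) := by
      refine Def.and (Def.isFunction hθ _) (Def.all (Def.imp (Def.mem _ _) (Def.alls
        (Def.imp (Def.forall_finite fun i => Def.pairMem hθ _ _ _) (Def.all (Def.imp
          (hT.relabel fun o => o.elim none fun i => some (Sum.inr i))
          (Def.ex (Def.and (Def.pairMem hθ _ _ _) ?_))))))))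
      exact hT.relabel fun o => o.elim none fun i => some (some (Sum.inr i))
    let q : Option α → H θ := fun o =>
      o.elim ⟨κ, hκH⟩ fun i => ⟨f i, hN.subset_H _ (hf i)⟩
    obtain ⟨g, hgN, hgfun, hg⟩ := hN.exists_mem R hR q
      (by rintro (_ | i) <;> [exact hκ; exact hf i]) (by
        classical
        let Q : ZFSet.{u} → H θ → Prop := fun z y =>
          ∃ w : α → H θ, (∀ i, ZFSet.pair z (w i) ∈ f i) ∧ T w y
        -- The default ∅ is harmless: `R` demands nothing where no witness exists.
        let F : ZFSet.{u} → ZFSet.{u} := fun z => if h : ∃ y, Q z y then h.choose else ∅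
        obtain ⟨g, hgH, hgfun, hg⟩ := exists_graph_mem_H hθ hκH F (by
          intro z _
          by_cases h : ∃ y, Q z y
          · simp only [F, dif_pos h]; exact h.choose.2
          · simp only [F, dif_neg h]; exact empty_mem_H hθ)
        refine ⟨⟨g, hgH⟩, hgfun, fun z hz w hw y hy => ?_⟩
        have h : ∃ y, Q z y := ⟨y, w, hw, hy⟩
        obtain ⟨w', hw', hT'⟩ := h.choose_spec
        have hww : w' = w := funext fun i => Subtype.ext ((hfun i).2 _ _ _ (hw' i) (hw i))
        refine ⟨h.choose, (hg _ _).2 ⟨hz, ?_⟩, hww ▸ hT'⟩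
        simp only [F, dif_pos h])
    obtain ⟨y, hyg, hy⟩ := hg ⟨ξ, H_mem_trans hκH hξ⟩ hξ p hfp y₀ hy₀
    exact ⟨y, ⟨g, hgN, hgfun, hyg⟩, hy⟩

/-- Each a ∈ N is the value at ξ of a function in N that takes the value a on all of κ. -/
theorem subset_hull (hθ : θ.IsRegular) (hN : Elem θ N) (hκ : κ ∈ N) (hξ : ξ ∈ κ) :
    N ⊆ Hull N ξ := by
  intro a ha
  have hκH := hN.subset_H κ hκ
  have haH := hN.subset_H a ha
  obtain ⟨g, hgN, hgfun, hg⟩ := hN.exists_mem (α := Fin 2)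
    (fun v g => IsFunction g ∧
      ∀ z : H θ, (z : ZFSet) ∈ (v 0 : ZFSet) → ZFSet.pair z (v 1) ∈ (g : ZFSet))
    (Def.and (Def.isFunction hθ _) (Def.all (Def.imp (Def.mem _ _) (Def.pairMem hθ _ _ _))))
    ![⟨κ, hκH⟩, ⟨a, haH⟩] (by simp [Fin.forall_fin_two, hκ, ha]) (by
      obtain ⟨g, hgH, hgfun, hg⟩ := exists_graph_mem_H hθ hκH (fun _ => a) fun _ _ => haH
      exact ⟨⟨g, hgH⟩, hgfun, fun z hz => (hg _ _).2 ⟨hz, rfl⟩⟩)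
  exact ⟨g, hgN, hgfun, hg ⟨ξ, H_mem_trans hκH hξ⟩ hξ⟩

end Elem

theorem countable_hull {N : Set ZFSet.{u}} (hN : N.Countable) (ξ : ZFSet.{u}) :
    (Hull N ξ).Countable := by
  have h : Hull N ξ ⊆ ⋃ f ∈ N, {y | IsFunction f ∧ ZFSet.pair ξ y ∈ f} := by
    rintro y ⟨f, hf, h⟩
    exact Set.mem_biUnion hf h
  refine (hN.biUnion fun f _ => Set.Subsingleton.countable ?_).mono h
  rintro a ⟨hf, ha⟩ b ⟨-, hb⟩
  exact hf.2 _ _ _ ha hb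

/-! ### Cardinals as sets -/

theorem isOrdinal_cardSet (c : Cardinal.{u}) : (cardSet c).IsOrdinal :=
  ZFSet.isOrdinal_toZFSet _

theorem cardSet_mem_cardSet {c d : Cardinal.{u}} : cardSet c ∈ cardSet d ↔ c < d := by
  rw [cardSet, cardSet, Ordinal.toZFSet_mem_toZFSet_iff, ord_lt_ord]

theorem card_cardSet (c : Cardinal.{u}) : (cardSet c).card = c := by
  rw [cardSet, Ordinal.card_toZFSet, card_ord]

theorem exists_bound_of_isRegular {c : Cardinal.{u}} (hc : c.IsRegular) {ι : Type u}
    (hι : #ι < c) (F : ι → ZFSet.{u}) (hF : ∀ i, F i ∈ cardSet c) :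
    ∃ δ ∈ cardSet c, ∀ i, F i ∈ δ := by
  have hord : ∀ i, (F i).IsOrdinal := fun i => (isOrdinal_cardSet c).mem (hF i)
  have hlt : ∀ i, (F i).rank + 1 < c.ord := by
    intro i
    have h := ((hord i).rank_lt_iff_mem (isOrdinal_cardSet c)).2 (hF i)
    rw [cardSet, Ordinal.rank_toZFSet] at h
    exact (isSuccLimit_ord hc.aleph0_le).add_one_lt h
  refine ⟨(⨆ i, ((F i).rank + 1)).toZFSet, ?_, fun i => ?_⟩
  · rw [cardSet, Ordinal.toZFSet_mem_toZFSet_iff]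
    exact Ordinal.iSup_lt_of_lt_cof (by rwa [hc.cof_ord]) hlt
  · rw [← (hord i).toZFSet_rank_eq, Ordinal.toZFSet_mem_toZFSet_iff]
    exact (lt_add_one _).trans_le (Ordinal.le_iSup (fun i => (F i).rank + 1) i)

theorem exists_bound_of_countable {c : Cardinal.{u}} (hc : c.IsRegular) (h1 : aleph 1 < c)
    {N : Set ZFSet.{u}} (hN : N.Countable) :
    ∃ δ ∈ cardSet c, ∀ α ∈ N, α ∈ cardSet c → α ∈ δ := by
  have hA : (N ∩ {α | α ∈ cardSet c}).Countable := hN.mono Set.inter_subset_left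
  have : Countable ↥(N ∩ {α | α ∈ cardSet c}) := hA
  have : Countable (Shrink.{u} ↥(N ∩ {α | α ∈ cardSet c})) :=
    (equivShrink _).symm.injective.countable
  obtain ⟨δ, hδ, h⟩ := exists_bound_of_isRegular hc (ι := Shrink.{u} ↥(N ∩ {α | α ∈ cardSet c}))
    ((mk_le_aleph0).trans_lt ((aleph0_lt_aleph_one).trans h1))
    (fun i => ((equivShrink _).symm i).1) fun i => ((equivShrink _).symm i).2.2
  refine ⟨δ, hδ, fun α hα hαc => ?_⟩
  have := h (equivShrink _ ⟨α, hα, hαc⟩)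
  simpa using this

/-- The bound δ depends on f, κ and lam but not on ξ, which is why it can be found in N. -/
theorem Elem.hull_bounded {θ c : Cardinal.{u}} {N : Set ZFSet.{u}} {κ ξ lam α : ZFSet.{u}}
    (hθ : θ.IsRegular) (hN : Elem θ N) (hκ : κ ∈ N) (hξ : ξ ∈ κ) (hlam : lam ∈ N)
    (hc : c.IsRegular) (hlc : lam = cardSet c) (hκc : κ.card < c) (hα : α ∈ Hull N ξ)
    (hαl : α ∈ lam) : ∃ δ ∈ N, δ ∈ lam ∧ α ∈ δ := by
  obtain ⟨f, hf, hfun, hfα⟩ := hα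
  have hκH := hN.subset_H κ hκ
  have hlH := hN.subset_H lam hlam
  have hfH := hN.subset_H f hf
  obtain ⟨δ, hδN, hδl, hδ⟩ := hN.exists_mem (α := Fin 3)
    (fun v δ => (δ : ZFSet) ∈ (v 1 : ZFSet) ∧
      ∀ z : H θ, (z : ZFSet) ∈ (v 0 : ZFSet) → ∀ y : H θ, (y : ZFSet) ∈ (v 1 : ZFSet) →
        ZFSet.pair z y ∈ (v 2 : ZFSet) → (y : ZFSet) ∈ (δ : ZFSet))
    (Def.and (Def.mem _ _) (Def.all (Def.imp (Def.mem _ _) (Def.all (Def.imp (Def.mem _ _)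
      (Def.imp (Def.pairMem hθ _ _ _) (Def.mem _ _)))))))
    ![⟨κ, hκH⟩, ⟨lam, hlH⟩, ⟨f, hfH⟩] (by
      intro i; fin_cases i <;> assumption) (by
      -- f may be undefined at points of κ or leave lam, so only the relevant points are indexed.
      let A : Set (Shrink.{u} κ) :=
        {i | ∃ y ∈ lam, ZFSet.pair ((equivShrink κ).symm i) y ∈ f}
      have hA : ∀ i : A, ∃ y ∈ lam, ZFSet.pair ((equivShrink κ).symm i.1) y ∈ f := fun i => i.2
      choose F hFl hFf using hA
      obtain ⟨δ, hδ, h⟩ := exists_bound_of_isRegular hc ((mk_set_le A).trans_lt hκc) F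
        fun i => hlc ▸ hFl i
      refine ⟨⟨δ, H_mem_trans hlH (hlc ▸ hδ)⟩, hlc ▸ hδ, fun z hz y hy hzy => ?_⟩
      have hi : equivShrink κ ⟨z, hz⟩ ∈ A := ⟨y, hy, by simpa using hzy⟩
      have e : F ⟨_, hi⟩ = y := hfun.2 z _ _ (by simpa using hFf ⟨_, hi⟩) hzy
      exact e ▸ h ⟨_, hi⟩)
  exact ⟨δ, hδN, hδl, hδ ⟨ξ, H_mem_trans hκH hξ⟩ hξ ⟨α, H_mem_trans hlH hαl⟩ hαl hfα⟩

/-! ### Measures -/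

/-- A formulation inside `H_θ` of `U` being a `κ`-complete ultrafilter on `κ` with no bounded
members. -/
def IsMeasureOn {θ : Cardinal.{u}} (κ U : H θ) : Prop :=
  (∀ X : H θ, X.1 ∈ U.1 → ∀ ξ : H θ, ξ.1 ∈ X.1 → ξ.1 ∈ κ.1) ∧
  (∀ X : H θ, X.1 ∈ U.1 → ∀ ν : H θ, ν.1 ∈ κ.1 → ∃ ξ : H θ, ξ.1 ∈ X.1 ∧ ¬ ξ.1 ∈ ν.1) ∧
  (∀ γ : H θ, γ.1 ∈ κ.1 → ∀ f : H θ, IsFunction f.1 → ∃ Z : H θ, Z.1 ∈ U.1 ∧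
    ∀ i : H θ, i.1 ∈ γ.1 → ∀ Y : H θ, Y.1 ∈ U.1 → ZFSet.pair i.1 Y.1 ∈ f.1 →
      ∀ ξ : H θ, ξ.1 ∈ Z.1 → ξ.1 ∈ Y.1) ∧
  (∀ γ : H θ, γ.1 ∈ κ.1 → ∀ f : H θ, ∃ X : H θ, X.1 ∈ U.1 ∧
    ((∃ c : H θ, ∀ ξ : H θ, ξ.1 ∈ X.1 → ZFSet.pair ξ.1 c.1 ∈ f.1) ∨
      ∀ ξ : H θ, ξ.1 ∈ X.1 → ∀ y : H θ, y.1 ∈ γ.1 → ¬ ZFSet.pair ξ.1 y.1 ∈ f.1))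

theorem Def.isMeasureOn {θ : Cardinal.{u}} (hθ : θ.IsRegular) {α : Type} (i j : α) :
    Def fun v : α → H θ => IsMeasureOn (v i) (v j) := by
  refine and (all (imp (mem _ _) (all (imp (mem _ _) (mem _ _)))))
    (and (all (imp (mem _ _) (all (imp (mem _ _) (ex (and (mem _ _) (not (mem _ _))))))))
    (and (all (imp (mem _ _) (all (imp (isFunction hθ _) (ex (and (mem _ _)
      (all (imp (mem _ _) (all (imp (mem _ _) (imp (pairMem hθ _ _ _)
        (all (imp (mem _ _) (mem _ _)))))))))))))) ?_))
  exact all (imp (mem _ _) (all (ex (and (mem _ _)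
    (or (ex (all (imp (mem _ _) (pairMem hθ _ _ _))))
      (all (imp (mem _ _) (all (imp (mem _ _) (not (pairMem hθ _ _ _)))))))))))

/-- Otherwise c ≤ 2^ℵ₀, and its points can be coded by sets of naturals. The ultrafilter decides
each bit; by completeness the decided bits hold simultaneously on a large set, which has only one
point. -/
theorem MeasurableCardinal.aleph_one_lt {c : Cardinal.{u}} (hc : MeasurableCardinal c) :
    aleph 1 < c := by
  obtain ⟨h0, U, hU, hcomp⟩ := hc
  by_contra! hle
  have h2 : #c.ord.ToType ≤ #(Set (ULift.{u} ℕ)) := by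
    rw [mk_ord_toType, mk_set]
    refine hle.trans (aleph_one_le_continuum.trans ?_)
    simp
  obtain ⟨g⟩ := h2
  have h3 : ∀ n : ULift.{u} ℕ, ∃ b : Prop, {k | n ∈ g k ↔ b} ∈ U := by
    intro n
    rcases U.mem_or_compl_mem {k | n ∈ g k} with h | h
    · exact ⟨True, by simpa using h⟩
    · exact ⟨False, by simpa [Set.compl_def] using h⟩
  choose b hb using h3
  have h4 : (⋂ n, {k | n ∈ g k ↔ b n}) ∈ (U : Filter c.ord.ToType) :=
    (Filter.cardinal_iInter_mem (by simpa using h0)).2 hb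
  obtain ⟨α, hα⟩ := U.nonempty_of_mem h4
  refine hU α (Filter.mem_of_superset h4 fun k hk => ?_)
  refine g.injective (Set.ext fun n => ?_)
  rw [Set.mem_iInter] at hk hα
  exact (hk n).trans (hα n).symm

/-- The ultrafilter, copied to a family of subsets of κ, is an element of P(P(κ)), hence of H_θ. -/
theorem exists_isMeasureOn {θ c : Cardinal.{u}} (hc : MeasurableCardinal c)
    (hP : (cardSet c).powerset.powerset ∈ H θ) (hκ : cardSet c ∈ H θ) :
    ∃ U : H θ, IsMeasureOn ⟨cardSet c, hκ⟩ U := by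
  obtain ⟨-, U, hU, hcomp⟩ := hc
  let e : c.ord.ToType → ZFSet.{u} := fun i => (i.toOrd : Ordinal).toZFSet
  have he : ∀ i, e i ∈ cardSet c := fun i => Ordinal.toZFSet_mem_toZFSet_iff.2 i.toOrd.2
  have he' : ∀ x ∈ cardSet c, ∃ i, e i = x := by
    intro x hx
    obtain ⟨a, ha, rfl⟩ := Ordinal.mem_toZFSet_iff.1 hx
    exact ⟨Ordinal.ToType.mk ⟨a, ha⟩, by simp [e, Ordinal.ToType.toOrd]⟩
  have hlt : ∀ i j, e j ∈ e i ↔ j < i := by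
    intro i j
    rw [Ordinal.toZFSet_mem_toZFSet_iff, Subtype.coe_lt_coe, Ordinal.ToType.toOrd,
      Ordinal.ToType.toOrd, OrderIso.lt_iff_lt]
  have hIio : ∀ i : c.ord.ToType, #(Set.Iio i) < c := fun i => by
    simpa using mk_Iio_lt i (by simp)
  let V : ZFSet.{u} := (cardSet c).powerset.sep fun X => {i | e i ∈ X} ∈ U
  have hV : ∀ X, X ∈ V ↔ X ⊆ cardSet c ∧ {i | e i ∈ X} ∈ U := fun X => by
    simp [V]
  have hsep : ∀ p : ZFSet.{u} → Prop, {i | p (e i)} ∈ U →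
      ∃ Z ∈ V, ∀ ξ ∈ Z, p ξ := fun p hp =>
    ⟨(cardSet c).sep p, (hV _).2 ⟨ZFSet.sep_subset, by simpa [he] using hp⟩,
      fun _ hξ => (ZFSet.mem_sep.1 hξ).2⟩
  have hVH : V ∈ H θ := H_mem_trans hP (ZFSet.mem_powerset.2 ZFSet.sep_subset)
  refine ⟨⟨V, hVH⟩, ?_, ?_, ?_, ?_⟩
  · exact fun X hX ξ hξ => ((hV _).1 hX).1 hξ
  · intro X hX ν hν
    by_contra! hcon
    obtain ⟨i, hi⟩ := he' _ hν
    have h1 : {j | e j ∈ ν.1} ∈ U := Filter.mem_of_superset ((hV _).1 hX).2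
      fun j hj => hcon ⟨e j, H_mem_trans X.2 hj⟩ hj
    -- The complement of the initial segment ν is an intersection of fewer than c complements of
    -- singletons.
    have h2 : (⋂ j : Set.Iio i, {j.1}ᶜ) ∈ (U : Filter c.ord.ToType) :=
      (Filter.cardinal_iInter_mem (hIio i)).2 fun j => Ultrafilter.compl_mem_iff_notMem.2 (hU _)
    obtain ⟨j, hj1, hj2⟩ := U.nonempty_of_mem (Filter.inter_mem h1 h2)
    rw [Set.mem_iInter] at hj2
    have hji : j < i := (hlt _ _).1 (hi ▸ hj1)
    exact hj2 ⟨j, hji⟩ rfl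
  · intro γ hγ f hf
    obtain ⟨i, hi⟩ := he' _ hγ
    have hA : (⋂ j : Set.Iio i, {k | ∀ Y ∈ V, ZFSet.pair (e j) Y ∈ f.1 → e k ∈ Y}) ∈
        (U : Filter c.ord.ToType) := by
      refine (Filter.cardinal_iInter_mem (hIio i)).2 fun j => ?_
      by_cases h : ∃ Y ∈ V, ZFSet.pair (e j) Y ∈ f.1
      · obtain ⟨Y, hY, hYf⟩ := h
        exact Filter.mem_of_superset ((hV _).1 hY).2 fun k hk Y' _ hY' =>
          hf.2 _ _ _ hYf hY' ▸ hk
      · push Not at h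
        exact Filter.mem_of_superset Filter.univ_mem fun k _ Y hY hY' => absurd hY' (h Y hY)
    obtain ⟨Z, hZV, hZ⟩ := hsep (fun ξ => ∀ j ∈ γ.1, ∀ Y ∈ V, ZFSet.pair j Y ∈ f.1 → ξ ∈ Y) (by
      refine Filter.mem_of_superset hA fun k hk x hx => ?_
      obtain ⟨j, rfl⟩ := he' x ((isOrdinal_cardSet c).mem_trans hx hγ)
      rw [Set.mem_iInter] at hk
      exact hk ⟨j, (hlt _ _).1 (hi ▸ hx)⟩)
    exact ⟨⟨Z, H_mem_trans hVH hZV⟩, hZV, fun j hj Y hY hjY ξ hξ =>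
      hZ ξ.1 hξ j.1 hj Y.1 hY hjY⟩
  · intro γ hγ f
    obtain ⟨i, hi⟩ := he' _ hγ
    -- Either one fibre over γ is large, or all the fibres, fewer than c, can be discarded together.
    by_cases h : ∃ j : Set.Iio i, {k | ZFSet.pair (e k) (e j) ∈ f.1} ∈ U
    · obtain ⟨j, hj⟩ := h
      obtain ⟨X, hXV, hX⟩ := hsep (fun ξ => ZFSet.pair ξ (e j) ∈ f.1) hj
      exact ⟨⟨X, H_mem_trans hVH hXV⟩, hXV, Or.inl ⟨⟨e j, H_mem_trans hκ (he j)⟩,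
        fun ξ hξ => hX ξ.1 hξ⟩⟩
    · push Not at h
      have hA : (⋂ j : Set.Iio i, {k | ZFSet.pair (e k) (e j) ∈ f.1}ᶜ) ∈
          (U : Filter c.ord.ToType) :=
        (Filter.cardinal_iInter_mem (hIio i)).2 fun j => Ultrafilter.compl_mem_iff_notMem.2 (h j)
      obtain ⟨X, hXV, hX⟩ := hsep (fun ξ => ∀ y ∈ γ.1, ¬ ZFSet.pair ξ y ∈ f.1) (by
        refine Filter.mem_of_superset hA fun k hk y hy => ?_
        obtain ⟨j, rfl⟩ := he' y ((isOrdinal_cardSet c).mem_trans hy hγ)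
        rw [Set.mem_iInter] at hk
        exact hk ⟨j, (hlt _ _).1 (hi ▸ hy)⟩)
      exact ⟨⟨X, H_mem_trans hVH hXV⟩, hXV, Or.inr fun ξ hξ y hy => hX ξ.1 hξ y.1 hy⟩

/-- ω ∈ κ, so the completeness clause applies to the sequence coded as a function on ω. -/
theorem IsMeasureOn.exists_subset_countable {θ c : Cardinal.{u}} (hθ : θ.IsRegular)
    (hc : aleph0 < c) {κ U : H θ} (hκ : κ.1 = cardSet c) (hU : IsMeasureOn κ U)
    (X : ℕ → ZFSet.{u}) (hX : ∀ n, X n ∈ U.1) : ∃ Z ∈ U.1, ∀ n, Z ⊆ X n := by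
  let ω : ZFSet.{u} := cardSet ℵ₀
  have hω : ω ∈ κ.1 := hκ ▸ cardSet_mem_cardSet.2 hc
  have hωH : ω ∈ H θ := H_mem_trans κ.2 hω
  let n' : ℕ → ZFSet.{u} := fun n => (n : Ordinal.{u}).toZFSet
  have hn' : ∀ n, n' n ∈ ω := fun n => by
    refine Ordinal.toZFSet_mem_toZFSet_iff.2 ?_
    rw [ord_aleph0]
    exact Ordinal.natCast_lt_omega0 n
  have hinj : Function.Injective n' := fun a b h => by
    simpa using Ordinal.toZFSet_injective h
  obtain ⟨f, hfH, hfun, hf⟩ := exists_graph_mem_H hθ hωH (fun z => X (Function.invFun n' z))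
    fun z _ => H_mem_trans U.2 (hX _)
  obtain ⟨Z, hZU, hZ⟩ := hU.2.2.1 ⟨ω, hωH⟩ hω ⟨f, hfH⟩ hfun
  refine ⟨Z, hZU, fun n ξ hξ => ?_⟩
  refine hZ ⟨n' n, H_mem_trans hωH (hn' n)⟩ (hn' n) ⟨X n, H_mem_trans U.2 (hX n)⟩ (hX n)
    ((hf _ _).2 ⟨hn' n, ?_⟩) ⟨ξ, H_mem_trans Z.2 hξ⟩ hξ
  simp [Function.leftInverse_invFun hinj n]

/-- A function in `N` is, on a set in a measure that belongs to `N`, either constant with value in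
`N` or outside of `γ`. -/
theorem Elem.exists_homogeneous {θ : Cardinal.{u}} (hθ : θ.IsRegular) {N : Set ZFSet.{u}}
    (hN : Elem θ N) {κ U : H θ} (hUN : U.1 ∈ N) (hU : IsMeasureOn κ U) {f γ : ZFSet.{u}}
    (hf : f ∈ N) (hγ : γ ∈ κ.1) :
    ∃ X ∈ U.1, (∃ c ∈ N, ∀ ξ ∈ X, ZFSet.pair ξ c ∈ f) ∨
      ∀ ξ ∈ X, ∀ y ∈ γ, ZFSet.pair ξ y ∉ f := by
  have hfH := hN.subset_H f hf
  have hγH : γ ∈ H θ := H_mem_trans κ.2 hγ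
  obtain ⟨X, hX, ⟨c, hc⟩ | h⟩ := hU.2.2.2 ⟨γ, hγH⟩ hγ ⟨f, hfH⟩
  · obtain ⟨c', hc'N, X', hX', hc'⟩ := hN.exists_mem (α := Fin 2)
      (fun v c => ∃ X : H θ, X.1 ∈ (v 0).1 ∧
        ∀ ξ : H θ, ξ.1 ∈ X.1 → ZFSet.pair ξ.1 c.1 ∈ (v 1).1)
      (Def.ex (Def.and (Def.mem _ _) (Def.all (Def.imp (Def.mem _ _) (Def.pairMem hθ _ _ _)))))
      ![U, ⟨f, hfH⟩] (by simp [Fin.forall_fin_two, hUN, hf]) ⟨c, X, hX, hc⟩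
    exact ⟨X', hX', Or.inl ⟨c', hc'N, fun ξ hξ => hc' ⟨ξ, H_mem_trans X'.2 hξ⟩ hξ⟩⟩
  · exact ⟨X, hX, Or.inr fun ξ hξ y hy =>
      h ⟨ξ, H_mem_trans X.2 hξ⟩ hξ ⟨y, H_mem_trans hγH hy⟩ hy⟩

theorem Elem.exists_hull_inter_subset {θ c : Cardinal.{u}} (hθ : θ.IsRegular) {N : Set ZFSet.{u}}
    (hN : Elem θ N) (hNc : N.Countable) (hc : MeasurableCardinal c) (hκN : cardSet c ∈ N)
    (hP : (cardSet c).powerset.powerset ∈ H θ) {ν : ZFSet.{u}} (hν : ν ∈ cardSet c)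
    {G : Set ZFSet.{u}} (hG : G.Countable) (hGκ : ∀ γ ∈ G, γ ∈ cardSet c) :
    ∃ ξ ∈ cardSet c, ξ ∉ ν ∧ ∀ γ ∈ G, ∀ α ∈ Hull N ξ, α ∈ γ → α ∈ N := by
  have hκH := hN.subset_H _ hκN
  obtain ⟨U, hUN, hU⟩ := hN.exists_mem (α := Unit) (fun v U => IsMeasureOn (v ()) U)
    (Def.isMeasureOn hθ _ _) (fun _ => ⟨cardSet c, hκH⟩) (fun _ => hκN)
    (exists_isMeasureOn hc hP hκH)
  have hex : ∀ p : ↥(N ×ˢ G), ∃ X ∈ U.1, (∃ d ∈ N, ∀ ξ ∈ X, ZFSet.pair ξ d ∈ p.1.1) ∨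
      ∀ ξ ∈ X, ∀ y ∈ p.1.2, ZFSet.pair ξ y ∉ p.1.1 := fun p =>
    hN.exists_homogeneous hθ hUN hU p.2.1 (hGκ _ p.2.2)
  choose X hXU hX using hex
  -- Any member of U would do: it makes the countable family nonempty, hence enumerable, even when G
  -- is empty.
  obtain ⟨X₀, hX₀, -⟩ := hU.2.2.2 ⟨ν, H_mem_trans hκH hν⟩ hν ⟨ν, H_mem_trans hκH hν⟩
  have hctb : (insert X₀.1 (Set.range X)).Countable := by
    have : Countable ↥(N ×ˢ G) := hNc.prod hG
    exact (Set.countable_range X).insert _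
  obtain ⟨Y, hY⟩ := hctb.exists_eq_range (Set.insert_nonempty _ _)
  obtain ⟨Z, hZU, hZ⟩ := hU.exists_subset_countable hθ hc.1 rfl Y (fun n => by
    have : Y n ∈ insert X₀.1 (Set.range X) := hY ▸ Set.mem_range_self n
    rcases this with h | ⟨p, h⟩
    · exact h ▸ hX₀
    · exact h ▸ hXU p)
  have hZH : Z ∈ H θ := H_mem_trans U.2 hZU
  obtain ⟨ξ, hξZ, hξν⟩ := hU.2.1 ⟨Z, hZH⟩ hZU ⟨ν, H_mem_trans hκH hν⟩ hν
  refine ⟨ξ, hU.1 ⟨Z, hZH⟩ hZU ξ hξZ, hξν, ?_⟩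
  rintro γ hγ α ⟨f, hf, hfun, hfα⟩ hαγ
  have hp : X ⟨(f, γ), hf, hγ⟩ ∈ Set.range Y := hY ▸ Or.inr (Set.mem_range_self _)
  obtain ⟨n, hn⟩ := hp
  have hξX : ξ.1 ∈ X ⟨(f, γ), hf, hγ⟩ := hn ▸ hZ n hξZ
  rcases hX ⟨(f, γ), hf, hγ⟩ with ⟨d, hd, h⟩ | h
  · exact hfun.2 _ _ _ hfα (h _ hξX) ▸ hd
  · exact absurd hfα (h _ hξX _ hαγ)

/-! ### The winning strategy -/

theorem powerset_mono_of_subset {x y : ZFSet.{u}} (h : x ⊆ y) :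
    x.powerset.powerset ⊆ y.powerset.powerset := by
  intro z hz
  rw [ZFSet.mem_powerset] at hz ⊢
  intro w hw
  have := ZFSet.mem_powerset.1 (hz hw)
  exact ZFSet.mem_powerset.2 fun v hv => h (this hv)

/-- The properties of the positions reached when PII follows the winning strategy. -/
structure GoodPosition (θ : Cardinal.{u}) (M : Set ZFSet.{u}) (K : ZFSet.{u})
    (r : List Round.{u}) : Prop where
  countable : (model M r).Countable
  elem : Elem θ (model M r)
  promise : ∀ p ∈ promise r, p.1 ∈ model M r ∧ IsRegularCardinal p.1 ∧ p.1 ∉ K ∧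
    ∀ α ∈ model M r, α ∈ p.1 → α ⊆ p.2

theorem GoodPosition.exists_beta {θ : Cardinal.{u}} {M : Set ZFSet.{u}} {K : ZFSet.{u}}
    {r : List Round.{u}} (h : GoodPosition θ M K r) {lam : ZFSet.{u}}
    (hlam : LegalLam M K r lam) : ∃ β ∈ lam, ∀ α ∈ model M r, α ∈ lam → α ⊆ β := by
  obtain ⟨-, ⟨c, hc, rfl⟩, h1, -, -⟩ := hlam
  obtain ⟨δ, hδ, hb⟩ := exists_bound_of_countable hc (cardSet_mem_cardSet.1 h1) h.countable
  exact ⟨δ, hδ, fun α hα hαc => ((isOrdinal_cardSet c).mem hδ).subset_of_mem (hb α hα hαc)⟩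

theorem GoodPosition.exists_xi {θ : Cardinal.{u}} (hθ : θ.IsRegular) {M : Set ZFSet.{u}}
    {K : ZFSet.{u}} (hK : ∀ κ ∈ K, IsMeasurableCardinal κ) (hKθ : MuchLess K.sUnion θ)
    {r : List Round.{u}} (h : GoodPosition θ M K r) {lam β κ ν : ZFSet.{u}}
    (hlam : LegalLam M K r lam) (hβ : ∀ α ∈ model M r, α ∈ lam → α ⊆ β)
    (hκ : LegalKappa M K r κ ν) : ∃ ξ, LegalXi M r ⟨lam, β, κ, ν, ξ⟩ := by
  obtain ⟨hκK, hκN, hν⟩ := hκ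
  obtain ⟨c, hc, rfl⟩ := hK κ hκK
  have hP : (cardSet c).powerset.powerset ∈ H θ := H_subset hKθ
    (powerset_mono_of_subset fun x hx => ZFSet.mem_sUnion.2 ⟨_, hκK, hx⟩)
  have hω : omegaOne ∈ cardSet c := cardSet_mem_cardSet.2 hc.aleph_one_lt
  obtain ⟨ξ, hξ, hξν, hhull⟩ := h.elem.exists_hull_inter_subset hθ h.countable hc hκN hP hν
    -- ω₁ is added by hand, which avoids showing that it belongs to the model.
    (G := insert omegaOne (model M r) ∩ {γ | γ ∈ cardSet c})
    ((h.countable.insert _).mono Set.inter_subset_left) fun γ hγ => hγ.2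
  have hsub := h.elem.subset_hull hθ hκN hξ
  refine ⟨ξ, hξ, hξν, Set.Subset.antisymm ?_ ?_, ?_⟩
  · exact fun α ⟨hα, hαω⟩ => ⟨hhull _ ⟨Set.mem_insert _ _, hω⟩ α hα hαω, hαω⟩
  · exact fun α ⟨hα, hαω⟩ => ⟨hsub hα, hαω⟩
  · intro p hp α hα hαp
    have hp' : p.1 ∈ model M r ∧ IsRegularCardinal p.1 ∧ p.1 ∉ K ∧
        ∀ α ∈ model M r, α ∈ p.1 → α ⊆ p.2 := by
      obtain ⟨a, ha, rfl⟩ := hp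
      rcases List.mem_cons.1 ha with rfl | ha
      · exact ⟨hlam.1, hlam.2.1, hlam.2.2.2.2, hβ⟩
      · exact h.promise _ ⟨a, ha, rfl⟩
    obtain ⟨hpN, ⟨d, hd, hpd⟩, hpK, hpb⟩ := hp'
    -- Above κ, α lies below some δ that the old promise already bounds; at κ, the promise would be
    -- a member of K; below κ, α is not new.
    rcases lt_trichotomy c d with hcd | rfl | hdc
    · obtain ⟨δ, hδN, hδ, hαδ⟩ := h.elem.hull_bounded hθ hκN hξ hpN hd hpd
        (by rwa [card_cardSet]) hα hαp
      have hδo : δ.IsOrdinal := (isOrdinal_cardSet d).mem (hpd ▸ hδ)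
      exact fun x hx => hpb δ hδN hδ (hδo.subset_of_mem hαδ hx)
    · exact absurd (hpd ▸ hκK) hpK
    · refine hpb α (hhull p.1 ⟨Or.inr hpN, ?_⟩ α hα hαp) hαp
      exact hpd ▸ cardSet_mem_cardSet.2 hdc

theorem GoodPosition.cons {θ : Cardinal.{u}} (hθ : θ.IsRegular) {M : Set ZFSet.{u}}
    {K : ZFSet.{u}} {r : List Round.{u}} (h : GoodPosition θ M K r) {a : Round.{u}}
    (hlam : LegalLam M K r a.lam) (hκ : LegalKappa M K r a.kappa a.nu) (hξ : LegalXi M r a) :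
    GoodPosition θ M K (a :: r) where
  countable := countable_hull h.countable _
  elem := h.elem.hull hθ hκ.2.1 hξ.1
  promise := by
    intro p hp
    have hsub := h.elem.subset_hull hθ hκ.2.1 hξ.1
    have hp' : p.1 ∈ model M r ∧ IsRegularCardinal p.1 ∧ p.1 ∉ K := by
      obtain ⟨b, hb, rfl⟩ := hp
      rcases List.mem_cons.1 hb with rfl | hb
      · exact ⟨hlam.1, hlam.2.1, hlam.2.2.2.2⟩
      · obtain ⟨h1, h2, h3, -⟩ := h.promise _ ⟨b, hb, rfl⟩
        exact ⟨h1, h2, h3⟩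
    exact ⟨hsub hp'.1, hp'.2.1, hp'.2.2, hξ.2.2.2 p hp⟩

open Classical in
/-- The strategy that bounds the current model below `lam` and then picks any legal `xi`. -/
noncomputable def boundingStrategy (M : Set ZFSet.{u}) : Strategy.{u} where
  beta r lam :=
    -- The default ∅ is never reached in a good position after a legal move of PI.
    if h : ∃ β ∈ lam, ∀ α ∈ model M r, α ∈ lam → α ⊆ β then h.choose else ∅
  xi r lam beta kappa nu :=
    if h : ∃ ξ, LegalXi M r ⟨lam, beta, kappa, nu, ξ⟩ then h.choose else ∅

theorem GoodPosition.boundingStrategy_beta {θ : Cardinal.{u}} {M : Set ZFSet.{u}} {K : ZFSet.{u}}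
    {r : List Round.{u}} (h : GoodPosition θ M K r) {lam : ZFSet.{u}}
    (hlam : LegalLam M K r lam) : (boundingStrategy M).beta r lam ∈ lam ∧
      ∀ α ∈ model M r, α ∈ lam → α ⊆ (boundingStrategy M).beta r lam := by
  have hβ := h.exists_beta hlam
  simpa only [boundingStrategy, dif_pos hβ] using hβ.choose_spec

theorem legalXi_boundingStrategy {M : Set ZFSet.{u}} {r : List Round.{u}}
    {lam kappa nu : ZFSet.{u}}
    (h : ∃ ξ, LegalXi M r ⟨lam, (boundingStrategy M).beta r lam, kappa, nu, ξ⟩) :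
    LegalXi M r ((boundingStrategy M).round r lam kappa nu) := by
  have e : (boundingStrategy M).xi r lam ((boundingStrategy M).beta r lam) kappa nu = h.choose :=
    dif_pos h
  rw [Strategy.round, e]
  exact h.choose_spec

/-- This holds for any strategy, since legality of ξ already contains the promise clause. The choice
of β matters only for the existence of ξ. -/
theorem Strategy.Run.goodPosition {θ : Cardinal.{u}} (hθ : θ.IsRegular) {M : Set ZFSet.{u}}
    {K : ZFSet.{u}} {S : Strategy.{u}} (hM : GoodPosition θ M K []) {r : List Round.{u}}
    (hr : S.Run M K r) : GoodPosition θ M K r := by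
  induction hr with
  | nil => exact hM
  | cons _ hlam _ hκ hξ ih => exact ih.cons hθ hlam hκ hξ

end NambaGame

theorem mainTheorem11 (K : ZFSet.{u}) (hK : ∀ κ ∈ K, NambaGame.IsMeasurableCardinal κ)
    (θ : Cardinal.{u}) (hθ : θ.IsRegular) (hKθ : NambaGame.MuchLess K.sUnion θ)
    (M : NambaGame.setLanguage.ElementarySubstructure (NambaGame.H θ))
    (hM : (NambaGame.elements M).Countable) :
    NambaGame.PIIHasWinningStrategy (NambaGame.elements M) K := by
  refine ⟨NambaGame.boundingStrategy (NambaGame.elements M), fun r hr lam hlam => ?_⟩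
  have hgood := hr.goodPosition hθ
    ⟨hM, NambaGame.elem_elements M, fun p ⟨_, ha, _⟩ => absurd ha List.not_mem_nil⟩
  obtain ⟨hβ, hβ'⟩ := hgood.boundingStrategy_beta hlam
  exact ⟨hβ, fun κ ν hκ => NambaGame.legalXi_boundingStrategy
    (hgood.exists_xi hθ hK hKθ hlam hβ' hκ)⟩
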